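/- A pencil of plane curves of degree $d$ is a two-dimensional linear subspace $L$ of the space of homogeneous polynomials of degree $d$ in $\mathbb{C}[x,y,z]$; its fibers are the curves $F=0$ with $0\neq F\in L$, where proportional $F$ define the same fiber, and its base locus $\mathcal{X}\subset\mathbb{P}^2(\mathbb{C})$ is the set of common zeros of all members of $L$. The pencil has no fixed components if the members of $L$ have no nonconstant common factor (so that $\mathcal{X}$ is finite). It is connected if, in the blow-up of $\mathbb{P}^2(\mathbb{C})$ at the points of $\mathcal{X}$, the proper transform of every fiber is connected. A curve is completely reducible if it has the form $\prod_{i=1}^q\alpha_i^{m_i}$ (up to a nonzero constant) with pairwise nonproportional nonzero linear forms $\alpha_i$ and positive integers $m_i$; its exponent is $\gcd(m_1,\dots,m_q)$. A Ceva pencil is a connected pencil of plane curves without fixed components that has at least three distinct completely reducible fibers. Theorem. Let $C_1,C_2,C_3$ be three distinct completely reducible fibers of a Ceva pencil whose exponents $e_1,e_2,e_3$ are all greater than $1$. Then $\{e_1,e_2,e_3\}=\{2,3,5\}$, and every completely reducible fiber of the pencil other than $C_1,C_2,C_3$ has exponent $1$. -/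

import Mathlib

open scoped LinearAlgebra.Projectivization

noncomputable section

namespace PlanePencil

/-- The complex projective plane. -/
abbrev Plane : Type := ℙ ℂ (Fin 3 → ℂ)

/-- The classical topology of the plane: the quotient topology from `ℂ³ \ {0}`. -/
instance : TopologicalSpace Plane :=
  inferInstanceAs (TopologicalSpace (Quotient (projectivizationSetoid ℂ (Fin 3 → ℂ))))

/-- Polynomials in three variables; the homogeneous ones define plane curves. -/
abbrev Poly : Type := MvPolynomial (Fin 3) ℂ

/-- The zero set in the plane of a homogeneous polynomial. -/
def curve (F : Poly) : Set Plane := {p | MvPolynomial.eval p.rep F = 0}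

/-- For homogeneous `F` the condition does not depend on the representative of the point. -/
theorem mk_mem_curve {F : Poly} {d : ℕ} (hF : F.IsHomogeneous d) (v : Fin 3 → ℂ) (hv : v ≠ 0) :
    Projectivization.mk ℂ v hv ∈ curve F ↔ MvPolynomial.eval v F = 0 := by
  obtain ⟨a, ha⟩ := Projectivization.exists_smul_eq_mk_rep ℂ v hv
  have h : MvPolynomial.eval ((a : ℂ) • v) F = (a : ℂ) ^ d * MvPolynomial.eval v F := by
    rw [MvPolynomial.eval_eq, MvPolynomial.eval_eq, Finset.mul_sum]
    refine Finset.sum_congr rfl fun m hm => ?_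
    have hd : ∑ i, m i = d := by
      have := hF (MvPolynomial.mem_support_iff.mp hm)
      rw [Finsupp.weight_apply, Finsupp.sum_fintype _ _ (by simp)] at this
      simpa using this
    rw [Finset.prod_subset (Finset.subset_univ m.support)
        (fun i _ hi => by simp [Finsupp.notMem_support_iff.mp hi]),
      Finset.prod_subset (Finset.subset_univ m.support)
        (fun i _ hi => by simp [Finsupp.notMem_support_iff.mp hi])]
    simp only [Pi.smul_apply, smul_eq_mul, mul_pow, Finset.prod_mul_distrib,
      Finset.prod_pow_eq_pow_sum, hd]
    ring
  have ha' : (a : ℂ) • v = (Projectivization.mk ℂ v hv).rep := ha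
  simp [curve, ← ha', h]

/-- Two polynomials that differ by a nonzero constant factor define the same curve
(with multiplicities). -/
def SameCurve (F G : Poly) : Prop := ∃ c : ℂ, c ≠ 0 ∧ G = c • F

/-- `F = c ∏ αᵢ ^ mᵢ` with pairwise nonproportional nonzero linear forms `αᵢ`, positive
multiplicities `mᵢ` and a nonzero constant `c`. -/
def IsLineFactorization (F : Poly) {q : ℕ} (α : Fin q → Poly) (m : Fin q → ℕ) : Prop :=
  (∀ i, (α i).IsHomogeneous 1 ∧ α i ≠ 0) ∧
  (∀ i j, i ≠ j → ¬ SameCurve (α i) (α j)) ∧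
  (∀ i, 0 < m i) ∧
  ∃ c : ℂ, c ≠ 0 ∧ F = c • ∏ i, α i ^ m i

/-- The curve `F` is a union of lines with multiplicities. -/
def IsCompletelyReducible (F : Poly) : Prop :=
  ∃ (q : ℕ) (α : Fin q → Poly) (m : Fin q → ℕ), IsLineFactorization F α m

/-- `F` is completely reducible and the greatest common divisor of the multiplicities of its
lines is `e`. -/
def HasExponent (F : Poly) (e : ℕ) : Prop :=
  ∃ (q : ℕ) (α : Fin q → Poly) (m : Fin q → ℕ),
    IsLineFactorization F α m ∧ Finset.univ.gcd m = e

/-- A pencil of plane curves of degree `d`: a projective line in the projective space of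
homogeneous polynomials of degree `d`. Its fibers are the nonzero elements of `L`, up to
constant factors. -/
def IsPencil (d : ℕ) (L : Submodule ℂ Poly) : Prop :=
  L ≤ MvPolynomial.homogeneousSubmodule (Fin 3) ℂ d ∧ Module.finrank ℂ L = 2

/-- The members of the pencil have no nonconstant common factor. -/
def HasNoFixedComponent (L : Submodule ℂ Poly) : Prop :=
  ∀ g : Poly, (∀ F ∈ L, g ∣ F) → IsUnit g

/-- The common zeros of all members of the pencil. -/
def baseLocus (L : Submodule ℂ Poly) : Set Plane := {p | ∀ F ∈ L, p ∈ curve F}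

/-- The blow-up of the plane at a finite set `X` of points: a point of it consists of a point `q`
of the plane and, for each `p ∈ X`, a line through `p` and `q`. For `q ≠ p` this line is
determined; for `q = p` it is an arbitrary tangent direction at `p`. A line is given by the point
of the dual plane formed by its coefficients. -/
abbrev BlowUp (X : Set Plane) : Type :=
  {s : Plane × (X → Plane) //
    ∀ p : X, Projectivization.orthogonal (s.2 p) p.1 ∧ Projectivization.orthogonal (s.2 p) s.1}

/-- The blow-down map to the plane. -/
def blowDown (X : Set Plane) (s : BlowUp X) : Plane := s.1.1

/-- The proper transform of the curve `F` in the blow-up at `X`. -/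
def properTransform (X : Set Plane) (F : Poly) : Set (BlowUp X) :=
  closure (blowDown X ⁻¹' (curve F \ X))

/-- In the blow-up at the base locus, the proper transform of every fiber is connected. -/
def IsConnectedPencil (L : Submodule ℂ Poly) : Prop :=
  ∀ F ∈ L, F ≠ 0 → IsConnected (properTransform (baseLocus L) F)

/-- A pencil of Ceva type: a connected pencil without fixed components that has at least three
completely reducible fibers. -/
structure IsCevaPencil (d : ℕ) (L : Submodule ℂ Poly) : Prop where
  isPencil : IsPencil d L
  noFixedComponent : HasNoFixedComponent L
  connected : IsConnectedPencil L
  three_fibers : ∃ F : Fin 3 → Poly,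
    (∀ i, F i ∈ L ∧ IsCompletelyReducible (F i)) ∧ ∀ i j, i ≠ j → ¬ SameCurve (F i) (F j)

end PlanePencil

end

/-! Two facts restrict the exponents. Coprimality (`coprime_exponents`): if two fibers have
exponents with gcd `n > 1`, then after scaling they are `A ^ n` and `B ^ n`, and any third
completely reducible fiber is `A ^ n - B ^ n`, the product of the `A - ζ B` over the `n`-th roots of
unity `ζ`. Its lines are distributed among these factors, and lines from different factors meet only
where `A = B = 0`, that is, in base points. Blowing these up separates the classes, contradicting
connectedness. Size (`lt_of_hasExponent`): the linear relation between three fibers is a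
Fermat–Catalan equation. Restricted to a generic line in a coordinate direction it has coprime, not
all constant solutions, which forces `1/e + 1/f + 1/g > 1`. Pairwise coprime integers greater than 1
with this property are 2, 3, 5. For a further fiber of exponent `g ≠ 1`, replacing one of the three
by it makes `g` one of 2, 3, 5, although `g` is coprime to all of them. -/

noncomputable section

namespace PlanePencil

open MvPolynomial

/-! ### Linear forms and points of the dual plane -/

/-- The coefficients of the linear part of a polynomial. -/
def coeffVec (α : Poly) (i : Fin 3) : ℂ := α.coeff (Finsupp.single i 1)

theorem eq_sum_coeffVec {α : Poly} (h : α.IsHomogeneous 1) : α = ∑ i, coeffVec α i • X i := by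
  have hmem : α ∈ homogeneousSubmodule (Fin 3) ℂ 1 := h
  rw [homogeneousSubmodule_one_eq_span_X, Submodule.mem_span_range_iff_exists_fun] at hmem
  obtain ⟨c, rfl⟩ := hmem
  refine Finset.sum_congr rfl fun i _ => ?_
  congr 1
  simp only [coeffVec, coeff_sum, coeff_smul, coeff_X, smul_eq_mul]
  rw [Finset.sum_eq_single i]
  · simp
  · intro b _ hb
    rw [if_neg, mul_zero]
    intro h
    exact hb ((Finsupp.single_left_inj one_ne_zero).mp h)
  · simp

theorem eval_linearForm {α : Poly} (h : α.IsHomogeneous 1) (v : Fin 3 → ℂ) :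
    eval v α = coeffVec α ⬝ᵥ v := by
  conv_lhs => rw [eq_sum_coeffVec h]
  simp [dotProduct, smul_eval]

theorem coeffVec_ne_zero {α : Poly} (h : α.IsHomogeneous 1) (h0 : α ≠ 0) : coeffVec α ≠ 0 := by
  intro hc
  apply h0
  rw [eq_sum_coeffVec h, hc]
  simp

theorem prime_linearForm {α : Poly} (h : α.IsHomogeneous 1) (h0 : α ≠ 0) : Prime α := by
  refine Irreducible.prime (irreducible_of_totalDegree_eq_one (h.totalDegree h0) fun x hx => ?_)
  rw [isUnit_iff_ne_zero]
  rintro rfl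
  exact h0 (MvPolynomial.ext _ _ fun m => by simpa using hx m)

/-- The point of the dual plane given by a nonzero linear form. -/
def dualPoint (α : Poly) (h : α.IsHomogeneous 1) (h0 : α ≠ 0) : Plane :=
  Projectivization.mk ℂ (coeffVec α) (coeffVec_ne_zero h h0)

theorem mem_curve_iff_orthogonal {α : Poly} (h : α.IsHomogeneous 1) (h0 : α ≠ 0) (p : Plane) :
    p ∈ curve α ↔ (dualPoint α h h0).orthogonal p := by
  induction p using Projectivization.ind with | h v hv =>
  rw [mk_mem_curve h, dualPoint, Projectivization.orthogonal_mk, eval_linearForm h]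

theorem sameCurve_of_dualPoint_eq {α β : Poly} (hα : α.IsHomogeneous 1) (hα0 : α ≠ 0)
    (hβ : β.IsHomogeneous 1) (hβ0 : β ≠ 0) (h : dualPoint α hα hα0 = dualPoint β hβ hβ0) :
    SameCurve β α := by
  obtain ⟨a, ha⟩ := (Projectivization.mk_eq_mk_iff ℂ _ _ _ _).mp h
  refine ⟨a, a.ne_zero, ?_⟩
  rw [eq_sum_coeffVec hα, eq_sum_coeffVec hβ, ← ha, Finset.smul_sum]
  refine Finset.sum_congr rfl fun i _ => ?_
  rw [smul_smul]
  rfl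

/-! ### Lines in the blow-up -/

theorem isClosed_preimage_mk {s : Set Plane}
    (h : IsClosed {v : {v : Fin 3 → ℂ // v ≠ 0} | Projectivization.mk ℂ v.1 v.2 ∈ s}) :
    IsClosed s :=
  (isQuotientMap_quotient_mk' (s := projectivizationSetoid ℂ (Fin 3 → ℂ))).isClosed_preimage.mp h

theorem isClosed_orthogonal (a : Plane) : IsClosed {p : Plane | a.orthogonal p} := by
  induction a using Projectivization.ind with | h a ha =>
  apply isClosed_preimage_mk
  simp only [Set.mem_ofPred_eq, Projectivization.orthogonal_mk]
  refine isClosed_eq ?_ continuous_const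
  exact (show Continuous fun v : Fin 3 → ℂ => ∑ i, a i * v i by fun_prop).comp
    continuous_subtype_val

/-- Proportionality to a fixed vector is the vanishing of a cross product, a closed condition.
Closed points make it a closed condition to prescribe the tangent direction in `lineTransform`. -/
instance : T1Space Plane where
  t1 a := by
    induction a using Projectivization.ind with | h a ha =>
    apply isClosed_preimage_mk
    simp only [Set.mem_singleton_iff, Projectivization.mk_eq_mk_iff_crossProduct_eq_zero]
    refine isClosed_eq ?_ continuous_const
    exact ((crossProduct (R := ℂ)).flip a).continuous_of_finiteDimensional.comp
      continuous_subtype_val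

/-- The proper transform of the line with coefficients `a` in the blow-up at `X`. -/
def lineTransform (X : Set Plane) (a : Plane) : Set (BlowUp X) :=
  {s | a.orthogonal s.1.1 ∧ ∀ p : X, a.orthogonal p.1 → s.1.2 p = a}

theorem isClosed_lineTransform (X : Set Plane) (a : Plane) : IsClosed (lineTransform X a) := by
  refine IsClosed.and ((isClosed_orthogonal a).preimage (by fun_prop)) ?_
  simp only [Set.ofPred_forall]
  refine isClosed_iInter fun p => isClosed_iInter fun _ => ?_
  exact (isClosed_singleton (x := a)).preimage (f := fun s : BlowUp X => s.1.2 p) (by fun_prop)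

/-- Two distinct points, here `p` and the image of `s`, lie on only one line. -/
theorem mem_lineTransform {X : Set Plane} {a : Plane} {s : BlowUp X} (hs : a.orthogonal s.1.1)
    (hX : s.1.1 ∉ X) : s ∈ lineTransform X a := by
  refine ⟨hs, fun p hp => ?_⟩
  rcases Configuration.ofField.eq_or_eq_of_orthogonal (s.2 p).1 hp (s.2 p).2 hs with h | h
  · exact h
  · exact absurd (h ▸ p.2) hX

/-- A common point would lie over a point of `X`, where its tangent direction would have to be both
`a` and `b`. -/
theorem disjoint_lineTransform {X : Set Plane} {a b : Plane} (hab : a ≠ b)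
    (h : ∀ p, a.orthogonal p → b.orthogonal p → p ∈ X) :
    Disjoint (lineTransform X a) (lineTransform X b) := by
  rw [Set.disjoint_left]
  intro s ha hb
  have hX := h _ ha.1 hb.1
  exact hab ((ha.2 ⟨_, hX⟩ ha.1).symm.trans (hb.2 ⟨_, hX⟩ hb.1))

theorem exists_blowDown_eq {X : Set Plane} {q : Plane} (hq : q ∉ X) :
    ∃ s : BlowUp X, blowDown X s = q := by
  have hne (p : X) : p.1 ≠ q := fun h => hq (h ▸ p.2)
  exact ⟨⟨(q, fun p => Projectivization.cross p.1 q), fun p =>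
    ⟨Projectivization.cross_orthogonal_left (hne p),
      Projectivization.cross_orthogonal_right (hne p)⟩⟩, rfl⟩

theorem mem_curve_lineFactorization {F : Poly} {q : ℕ} {α : Fin q → Poly} {m : Fin q → ℕ}
    (h : IsLineFactorization F α m) (p : Plane) : p ∈ curve F ↔ ∃ i, p ∈ curve (α i) := by
  obtain ⟨-, -, hm, c, hc, rfl⟩ := h
  simp only [curve, Set.mem_ofPred_eq, smul_eval, map_prod, map_pow, mul_eq_zero, hc, false_or,
    Finset.prod_eq_zero_iff, Finset.mem_univ, true_and, pow_eq_zero_iff (hm _).ne']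

/-- If the lines of a curve fall into two nonempty classes such that lines of different classes
meet only in `X`, then the proper transform of the curve in the blow-up at `X` is not connected. -/
theorem not_isConnected_properTransform {X : Set Plane} {F : Poly} {q : ℕ} {α : Fin q → Poly}
    {m : Fin q → ℕ} (h : IsLineFactorization F α m) (P : Fin q → Prop) (hP : ∃ i, P i)
    (hP' : ∃ i, ¬ P i) (hX : ∀ i, ∃ p ∈ curve (α i), p ∉ X)
    (hPX : ∀ i j, P i → ¬ P j → curve (α i) ∩ curve (α j) ⊆ X) :
    ¬ IsConnected (properTransform X F) := by
  intro hconn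
  let a (i : Fin q) : Plane := dualPoint (α i) (h.1 i).1 (h.1 i).2
  have ha (i : Fin q) (p : Plane) : p ∈ curve (α i) ↔ (a i).orthogonal p :=
    mem_curve_iff_orthogonal _ _ _
  have hclosed (Q : Fin q → Prop) : IsClosed (⋃ i ∈ {i | Q i}, lineTransform X (a i)) :=
    (Set.toFinite _).isClosed_biUnion fun i _ => isClosed_lineTransform X (a i)
  have hmeet (Q : Fin q → Prop) (hQ : ∃ i, Q i) :
      (properTransform X F ∩ ⋃ i ∈ {i | Q i}, lineTransform X (a i)).Nonempty := by
    obtain ⟨i, hi⟩ := hQ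
    obtain ⟨p, hp, hpX⟩ := hX i
    obtain ⟨s, rfl⟩ := exists_blowDown_eq hpX
    refine ⟨s, subset_closure ⟨(mem_curve_lineFactorization h _).mpr ⟨i, hp⟩, hpX⟩, ?_⟩
    exact Set.mem_biUnion hi (mem_lineTransform ((ha i _).mp hp) hpX)
  have hsub : properTransform X F ⊆ (⋃ i ∈ {i | P i}, lineTransform X (a i)) ∪
      ⋃ i ∈ {i | ¬ P i}, lineTransform X (a i) := by
    refine closure_minimal ?_ ((hclosed P).union (hclosed fun i => ¬ P i))
    rintro s ⟨hs, hsX⟩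
    obtain ⟨i, hi⟩ := (mem_curve_lineFactorization h _).mp hs
    have hsi := mem_lineTransform ((ha i _).mp hi) hsX
    by_cases hPi : P i
    · exact Or.inl (Set.mem_biUnion hPi hsi)
    · exact Or.inr (Set.mem_biUnion hPi hsi)
  -- Connectedness makes the two closed unions meet, so the transforms of two lines of different
  -- classes would meet.
  obtain ⟨s, -, hs, hs'⟩ := isPreconnected_closed_iff.mp hconn.isPreconnected _ _ (hclosed P)
    (hclosed fun i => ¬ P i) hsub (hmeet _ hP) (hmeet _ hP')
  simp only [Set.mem_iUnion, Set.mem_ofPred_eq, exists_prop] at hs hs'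
  obtain ⟨i, hi, hsi⟩ := hs
  obtain ⟨j, hj, hsj⟩ := hs'
  have hij : i ≠ j := fun hij => hj (hij ▸ hi)
  refine Set.disjoint_left.mp (disjoint_lineTransform (X := X) (a := a i) (b := a j) ?_ ?_) hsi hsj
  · exact fun he => h.2.1 j i hij.symm (sameCurve_of_dualPoint_eq _ _ _ _ he)
  · exact fun p hpi hpj => hPX i j hi hj ⟨(ha i p).mpr hpi, (ha j p).mpr hpj⟩

/-! ### Fibers, relations and fixed components -/

theorem IsLineFactorization.ne_zero {F : Poly} {q : ℕ} {α : Fin q → Poly} {m : Fin q → ℕ}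
    (h : IsLineFactorization F α m) : F ≠ 0 := by
  obtain ⟨hα, -, -, c, hc, rfl⟩ := h
  exact smul_ne_zero hc (Finset.prod_ne_zero_iff.mpr fun i _ => pow_ne_zero _ (hα i).2)

theorem IsCompletelyReducible.ne_zero {F : Poly} (h : IsCompletelyReducible F) : F ≠ 0 := by
  obtain ⟨q, α, m, h⟩ := h
  exact h.ne_zero

theorem HasExponent.isCompletelyReducible {F : Poly} {e : ℕ} (h : HasExponent F e) :
    IsCompletelyReducible F := by
  obtain ⟨q, α, m, h, -⟩ := h
  exact ⟨q, α, m, h⟩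

theorem IsLineFactorization.dvd {F : Poly} {q : ℕ} {α : Fin q → Poly} {m : Fin q → ℕ}
    (h : IsLineFactorization F α m) (i : Fin q) : α i ∣ F := by
  obtain ⟨-, -, hm, c, hc, rfl⟩ := h
  refine dvd_smul_of_dvd c ?_
  exact (dvd_pow_self _ (hm i).ne').trans (Finset.dvd_prod_of_mem _ (Finset.mem_univ i))

theorem SameCurve.symm {F G : Poly} (h : SameCurve F G) : SameCurve G F := by
  obtain ⟨c, hc, rfl⟩ := h
  exact ⟨c⁻¹, inv_ne_zero hc, by rw [smul_smul, inv_mul_cancel₀ hc, one_smul]⟩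

theorem exists_eq_smul_add_smul {L : Submodule ℂ Poly} (hL : Module.finrank ℂ L = 2) {F G : Poly}
    (hF : F ∈ L) (hG : G ∈ L) (hF0 : F ≠ 0) (hG0 : G ≠ 0) (hFG : ¬ SameCurve F G) {H : Poly}
    (hH : H ∈ L) : ∃ a b : ℂ, H = a • F + b • G := by
  have hli : LinearIndependent ℂ ![F, G] := by
    rw [LinearIndependent.pair_iff' hF0]
    rintro a rfl
    exact hFG ⟨a, fun ha => hG0 (by rw [ha, zero_smul]), rfl⟩
  have : FiniteDimensional ℂ L := Module.finite_of_finrank_pos (by omega)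
  have hspan : Submodule.span ℂ (Set.range ![F, G]) = L := by
    apply Submodule.eq_of_le_of_finrank_eq
    · rw [Submodule.span_le]
      rintro _ ⟨i, rfl⟩
      fin_cases i
      exacts [hF, hG]
    · rw [finrank_span_eq_card hli, hL, Fintype.card_fin]
  rw [← hspan, Submodule.mem_span_range_iff_exists_fun] at hH
  obtain ⟨c, rfl⟩ := hH
  exact ⟨c 0, c 1, by simp⟩

theorem exists_relation {L : Submodule ℂ Poly} (hL : Module.finrank ℂ L = 2) {F G H : Poly}
    (hF : F ∈ L) (hG : G ∈ L) (hH : H ∈ L) (hF0 : F ≠ 0) (hG0 : G ≠ 0) (hH0 : H ≠ 0)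
    (hFG : ¬ SameCurve F G) (hFH : ¬ SameCurve F H) (hGH : ¬ SameCurve G H) :
    ∃ a b : ℂ, a ≠ 0 ∧ b ≠ 0 ∧ H = a • F + b • G := by
  obtain ⟨a, b, rfl⟩ := exists_eq_smul_add_smul hL hF hG hF0 hG0 hFG hH
  refine ⟨a, b, ?_, ?_, rfl⟩
  · rintro rfl
    rw [zero_smul, zero_add] at hH0 hGH
    exact hGH ⟨b, left_ne_zero_of_smul hH0, rfl⟩
  · rintro rfl
    rw [zero_smul, add_zero] at hH0 hFH
    exact hFH ⟨a, left_ne_zero_of_smul hH0, rfl⟩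

theorem degree_ne_zero {d : ℕ} {F G : Poly} (hF : F.IsHomogeneous d) (hG : G.IsHomogeneous d)
    (hF0 : F ≠ 0) (hG0 : G ≠ 0) (hFG : ¬ SameCurve F G) : d ≠ 0 := by
  rintro rfl
  have hF' := totalDegree_eq_zero_iff_eq_C.mp (hF.totalDegree hF0)
  have hG' := totalDegree_eq_zero_iff_eq_C.mp (hG.totalDegree hG0)
  have hF1 : F.coeff 0 ≠ 0 := fun h => hF0 (by rw [hF', h, C_0])
  have hG1 : G.coeff 0 ≠ 0 := fun h => hG0 (by rw [hG', h, C_0])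
  refine hFG ⟨G.coeff 0 / F.coeff 0, div_ne_zero hG1 hF1, ?_⟩
  conv_lhs => rw [hG']
  conv_rhs => rw [hF']
  rw [smul_eq_C_mul, ← C_mul, coeff_zero_C, div_mul_cancel₀ _ hF1]

theorem eval_zero_of_isHomogeneous {d : ℕ} (hd : d ≠ 0) {F : Poly} (hF : F.IsHomogeneous d) :
    eval 0 F = 0 := by
  rw [eval_zero, constantCoeff_eq]
  exact hF.coeff_eq_zero (by simpa using hd.symm)

/-- This is the Nullstellensatz: `α` is prime, so it generates a radical ideal. The origin gives no
point of the plane and is covered by `d ≠ 0`. -/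
theorem dvd_of_curve_subset {d : ℕ} (hd : d ≠ 0) {α F : Poly} (hα : α.IsHomogeneous 1)
    (hα0 : α ≠ 0) (hF : F.IsHomogeneous d) (h : curve α ⊆ curve F) : α ∣ F := by
  have hp := prime_linearForm hα hα0
  have hmem : F ∈ vanishingIdeal ℂ (zeroLocus ℂ (Ideal.span {α})) := by
    rw [mem_vanishingIdeal_iff]
    intro v hv
    have hv' : eval v α = 0 := by
      simpa [aeval_eq_eval] using hv α (Ideal.mem_span_singleton_self α)
    rw [aeval_eq_eval]
    by_cases hv0 : v = 0
    · subst hv0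
      exact eval_zero_of_isHomogeneous hd hF
    · exact (mk_mem_curve hF v hv0).mp (h ((mk_mem_curve hα v hv0).mpr hv'))
  rw [vanishingIdeal_zeroLocus_eq_radical,
    ((Ideal.span_singleton_prime hα0).mpr hp).isRadical.radical] at hmem
  exact Ideal.mem_span_singleton.mp hmem

theorem exists_mem_curve_notMem_baseLocus {d : ℕ} (hd : d ≠ 0) {L : Submodule ℂ Poly}
    (hL : L ≤ homogeneousSubmodule (Fin 3) ℂ d) (hfix : HasNoFixedComponent L) {α : Poly}
    (hα : α.IsHomogeneous 1) (hα0 : α ≠ 0) : ∃ p ∈ curve α, p ∉ baseLocus L := by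
  by_contra! h
  refine (prime_linearForm hα hα0).not_isUnit (hfix α fun F hF => ?_)
  exact dvd_of_curve_subset hd hα hα0 (hL hF) fun p hp => h p hp F hF

/-! ### Powers in the pencil and coprimality of exponents -/

/-- Constants have `n`-th roots in `ℂ`. The vanishing of `A` at the origin later shows that the
factors `A - z • B` are not units. -/
theorem HasExponent.exists_smul_eq_pow {F : Poly} {e n : ℕ} (h : HasExponent F e) (he : e ≠ 0)
    (hn : n ∣ e) (a : ℂ) : ∃ A : Poly, a • F = A ^ n ∧ eval 0 A = 0 := by
  obtain ⟨q, α, m, ⟨hα, -, hm, c, -, rfl⟩, rfl⟩ := h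
  have hn0 : 0 < n := Nat.pos_of_dvd_of_pos hn (Nat.pos_of_ne_zero he)
  have hnm (i : Fin q) : n ∣ m i := hn.trans (Finset.gcd_dvd (Finset.mem_univ i))
  -- The gcd of an empty family is 0, so `e ≠ 0` provides a line.
  have hq : Nonempty (Fin q) := by
    by_contra hq
    rw [not_nonempty_iff] at hq
    exact he (by simp [Finset.univ_eq_empty])
  obtain ⟨i⟩ := hq
  obtain ⟨r, hr⟩ := IsAlgClosed.exists_pow_nat_eq (a * c) hn0
  refine ⟨r • ∏ i, α i ^ (m i / n), ?_, ?_⟩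
  · rw [smul_pow, hr, smul_smul, ← Finset.prod_pow]
    simp_rw [← pow_mul, Nat.div_mul_cancel (hnm _)]
  · rw [smul_eval, map_prod, Finset.prod_eq_zero (Finset.mem_univ i), mul_zero]
    rw [map_pow, eval_zero_of_isHomogeneous one_ne_zero (hα i).1]
    exact zero_pow (Nat.div_pos (Nat.le_of_dvd (hm i) (hnm i)) hn0).ne'

theorem IsLineFactorization.exists_dvd {F : Poly} {q : ℕ} {α : Fin q → Poly} {m : Fin q → ℕ}
    (h : IsLineFactorization F α m) {g : Poly} (hg : g ∣ F) (hu : ¬ IsUnit g) :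
    ∃ i, α i ∣ g := by
  have hg0 : g ≠ 0 := ne_zero_of_dvd_ne_zero h.ne_zero hg
  obtain ⟨p, hp, hpg⟩ := WfDvdMonoid.exists_irreducible_factor hu hg0
  obtain ⟨hα, -, hm, c, hc, rfl⟩ := h
  have hpF : p ∣ ∏ i, α i ^ m i := by
    have := hpg.trans hg
    rw [smul_eq_C_mul] at this
    exact ((isUnit_iff_ne_zero.mpr hc).map C).dvd_mul_left.mp this
  obtain ⟨i, -, hi⟩ := hp.prime.exists_mem_finset_dvd hpF
  have hirr := (prime_linearForm (hα i).1 (hα i).2).irreducible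
  exact ⟨i, (hp.associated_of_dvd hirr (hp.prime.dvd_of_dvd_pow hi)).symm.dvd.trans hpg⟩

theorem exists_dvd_sub_smul {n : ℕ} (hn : n ≠ 0) {A B α : Poly} (hα : Prime α)
    (h : α ∣ A ^ n - B ^ n) : ∃ z : ℂ, z ^ n = 1 ∧ α ∣ A - z • B := by
  have : NeZero n := ⟨hn⟩
  have hζ := Complex.isPrimitiveRoot_exp n hn
  have hζ' := hζ.map_of_injective (f := (C : ℂ →+* Poly)) (C_injective _ _)
  rw [hζ'.pow_sub_pow_eq_prod_sub_mul _ _ (Nat.pos_of_ne_zero hn)] at h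
  obtain ⟨ξ, hξ, hdvd⟩ := hα.exists_mem_finset_dvd h
  rw [Polynomial.mem_nthRootsFinset (Nat.pos_of_ne_zero hn)] at hξ
  -- The roots of unity of the polynomial ring are powers of a constant, hence constants.
  obtain ⟨i, -, rfl⟩ := hζ'.eq_pow_of_pow_eq_one hξ
  refine ⟨Complex.exp (2 * Real.pi * Complex.I / n) ^ i, ?_, ?_⟩
  · rw [pow_right_comm, hζ.pow_eq_one, one_pow]
  · rw [smul_eq_C_mul, map_pow]
    exact hdvd

/-- Two `n`-th powers in a connected pencil, `n > 1`, exclude a third completely reducible fiber: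
it would split into lines from different members of the pencil spanned by the `n`-th roots. -/
theorem coprime_exponents {d : ℕ} {L : Submodule ℂ Poly} (hL : IsPencil d L)
    (hfix : HasNoFixedComponent L) (hconn : IsConnectedPencil L) {F G H : Poly} (hF : F ∈ L)
    (hG : G ∈ L) (hH : H ∈ L) (hFG : ¬ SameCurve F G) (hFH : ¬ SameCurve F H)
    (hGH : ¬ SameCurve G H) {e f : ℕ} (he : HasExponent F e) (hf : HasExponent G f)
    (hHred : IsCompletelyReducible H) (he0 : e ≠ 0) (hf0 : f ≠ 0) : Nat.Coprime e f := by
  by_contra hcop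
  have hF0 := he.isCompletelyReducible.ne_zero
  have hG0 := hf.isCompletelyReducible.ne_zero
  have hd := degree_ne_zero (hL.1 hF) (hL.1 hG) hF0 hG0 hFG
  obtain ⟨a, b, ha, hb, hrel⟩ :=
    exists_relation hL.2 hF hG hH hF0 hG0 hHred.ne_zero hFG hFH hGH
  set n := Nat.gcd e f with hn
  have hn0 : n ≠ 0 := (Nat.gcd_pos_of_pos_left _ (Nat.pos_of_ne_zero he0)).ne'
  obtain ⟨A, hA, hA0⟩ := he.exists_smul_eq_pow he0 (Nat.gcd_dvd_left e f) a
  obtain ⟨B, hB, hB0⟩ := hf.exists_smul_eq_pow hf0 (Nat.gcd_dvd_right e f) (-b)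
  have hHAB : H = A ^ n - B ^ n := by
    rw [← hA, ← hB, hrel, neg_smul, sub_neg_eq_add]
  obtain ⟨q, α, m, hfac⟩ := hHred
  have hmem {p : Plane} (hpA : eval p.rep A = 0) (hpB : eval p.rep B = 0) : p ∈ baseLocus L := by
    intro K hK
    obtain ⟨s, t, rfl⟩ := exists_eq_smul_add_smul hL.2 hF hG hF0 hG0 hFG hK
    have hpF : a * eval p.rep F = 0 := by
      rw [← smul_eval, hA, map_pow, hpA, zero_pow hn0]
    have hpG : -b * eval p.rep G = 0 := by
      rw [← smul_eval, hB, map_pow, hpB, zero_pow hn0]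
    have hpF' := (mul_eq_zero.mp hpF).resolve_left ha
    have hpG' := (mul_eq_zero.mp hpG).resolve_left (neg_ne_zero.mpr hb)
    simp [curve, smul_eval, hpF', hpG']
  -- A line in two different factors divides `A` and `B`, hence `F` and `G`, and would be a fixed
  -- component.
  have hndvd (i : Fin q) (z w : ℂ) (hzw : z ≠ w) (hz : α i ∣ A - z • B)
      (hw : α i ∣ A - w • B) : False := by
    have hi := prime_linearForm (hfac.1 i).1 (hfac.1 i).2
    have hB' : α i ∣ B := by
      have h1 := dvd_sub hw hz
      have h2 : A - w • B - (A - z • B) = (z - w) • B := by rw [sub_smul]; abel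
      rw [h2, smul_eq_C_mul] at h1
      exact ((isUnit_iff_ne_zero.mpr (sub_ne_zero.mpr hzw)).map C).dvd_mul_left.mp h1
    have hA' : α i ∣ A := by
      have := dvd_add hz (dvd_smul_of_dvd z hB')
      rwa [sub_add_cancel] at this
    have hFi : α i ∣ F := by
      have : α i ∣ a • F := hA ▸ dvd_pow hA' hn0
      rw [smul_eq_C_mul] at this
      exact ((isUnit_iff_ne_zero.mpr ha).map C).dvd_mul_left.mp this
    have hGi : α i ∣ G := by
      have : α i ∣ (-b) • G := hB ▸ dvd_pow hB' hn0
      rw [smul_eq_C_mul] at this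
      exact ((isUnit_iff_ne_zero.mpr (neg_ne_zero.mpr hb)).map C).dvd_mul_left.mp this
    refine hi.not_isUnit (hfix _ fun K hK => ?_)
    obtain ⟨s, t, rfl⟩ := exists_eq_smul_add_smul hL.2 hF hG hF0 hG0 hFG hK
    exact dvd_add (dvd_smul_of_dvd s hFi) (dvd_smul_of_dvd t hGi)
  have hex (z : ℂ) (hz : z ^ n = 1) : ∃ i, α i ∣ A - z • B := by
    refine hfac.exists_dvd ?_ fun hu => ?_
    · have := sub_dvd_pow_sub_pow A (z • B) n
      rwa [smul_pow, hz, one_smul, ← hHAB] at this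
    · have := hu.map (eval 0)
      rw [map_sub, smul_eval, hA0, hB0, mul_zero, sub_zero] at this
      exact not_isUnit_zero this
  have hζ := Complex.isPrimitiveRoot_exp n hn0
  -- The first class consists of the lines of the factor `A - B`; a primitive root of unity,
  -- different from 1 as `n > 1`, gives a line outside it.
  refine not_isConnected_properTransform (X := baseLocus L) hfac (fun i => α i ∣ A - (1 : ℂ) • B)
    (hex 1 (one_pow n)) ?_ ?_ ?_ (hconn H hH hfac.ne_zero)
  · obtain ⟨i, hi⟩ := hex _ hζ.pow_eq_one
    exact ⟨i, fun h => hndvd i _ _ (hζ.ne_one (by omega)) hi h⟩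
  · exact fun i => exists_mem_curve_notMem_baseLocus hd hL.1 hfix (hfac.1 i).1 (hfac.1 i).2
  · rintro i j hi hj p ⟨hpi, hpj⟩
    obtain ⟨z, -, hz⟩ := exists_dvd_sub_smul hn0 (prime_linearForm (hfac.1 j).1 (hfac.1 j).2)
      (hHAB ▸ hfac.dvd j)
    have hz1 : z ≠ 1 := by
      rintro rfl
      exact hj hz
    have eval_dvd {g k : Poly} (hgk : g ∣ k) (hg : p ∈ curve g) : eval p.rep k = 0 := by
      obtain ⟨l, rfl⟩ := hgk
      rw [map_mul, show eval p.rep g = 0 from hg, zero_mul]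
    have h1 := eval_dvd hi hpi
    have h2 := eval_dvd hz hpj
    simp only [map_sub, smul_eval, one_mul] at h1 h2
    have hpB : eval p.rep B = 0 := by
      refine (mul_eq_zero.mp (?_ : (z - 1) * eval p.rep B = 0)).resolve_left (sub_ne_zero.mpr hz1)
      linear_combination h1 - h2
    exact hmem (by linear_combination h1 + hpB) hpB

/-! ### Reduction to one variable and the Fermat–Catalan theorem -/

/-- The substitution `X k ↦ X k + T`, with values in univariate polynomials in `T` over the field
of rational functions. -/
def shift (k : Fin 3) : Poly →ₐ[ℂ] Polynomial (FractionRing Poly) :=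
  aeval fun j => Polynomial.C (algebraMap Poly (FractionRing Poly) (X j)) +
    Polynomial.C (if j = k then 1 else 0) * Polynomial.X

theorem shift_linearForm (k : Fin 3) {α : Poly} (h : α.IsHomogeneous 1) :
    shift k α = Polynomial.C (algebraMap Poly (FractionRing Poly) α) +
      Polynomial.C (algebraMap ℂ (FractionRing Poly) (coeffVec α k)) * Polynomial.X := by
  have key (c : ℂ) : algebraMap ℂ (Polynomial (FractionRing Poly)) c =
      Polynomial.C (algebraMap ℂ (FractionRing Poly) c) := rfl
  have key' (c : ℂ) : algebraMap Poly (FractionRing Poly) (C c) =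
      algebraMap ℂ (FractionRing Poly) c := rfl
  conv_lhs => rw [eq_sum_coeffVec h]
  conv_rhs => enter [1]; rw [eq_sum_coeffVec h]
  simp only [shift, Fin.sum_univ_three, smul_eq_C_mul, map_add, map_mul, algHom_C, aeval_X, key',
    key]
  fin_cases k <;> simp <;> ring

theorem shift_linearForm_ne_zero (k : Fin 3) {α : Poly} (h : α.IsHomogeneous 1) (h0 : α ≠ 0) :
    shift k α ≠ 0 := by
  intro hs
  have := congrArg (Polynomial.eval 0) hs
  rw [shift_linearForm k h] at this
  simp at this
  exact h0 this

theorem natDegree_shift_linearForm {k : Fin 3} {α : Poly} (h : α.IsHomogeneous 1)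
    (hk : coeffVec α k ≠ 0) : (shift k α).natDegree = 1 := by
  rw [shift_linearForm k h, add_comm]
  exact Polynomial.natDegree_linear (by simpa using hk)

theorem isCoprime_of_isUnit {R : Type*} [CommRing R] {x y a b u : R} (h : a * x + b * y = u)
    (hu : IsUnit u) : IsCoprime x y := by
  obtain ⟨v, rfl⟩ := hu
  exact ⟨↑v⁻¹ * a, ↑v⁻¹ * b, by rw [mul_assoc, mul_assoc, ← mul_add, h, Units.inv_mul]⟩

/-- Eliminating `T` from the two linear polynomials leaves `coeffVec β k • α - coeffVec α k • β`, a
nonzero constant of the coefficient field. If `coeffVec α k = 0`, then the image of `α` is itself a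
unit. -/
theorem isCoprime_shift (k : Fin 3) {α β : Poly} (hα : α.IsHomogeneous 1) (hα0 : α ≠ 0)
    (hβ : β.IsHomogeneous 1) (hβ0 : β ≠ 0) (h : ¬ SameCurve α β) :
    IsCoprime (shift k α) (shift k β) := by
  have isUnit_C {x : Poly} (hx : x ≠ 0) :
      IsUnit (Polynomial.C (algebraMap Poly (FractionRing Poly) x)) :=
    Polynomial.isUnit_C.mpr (isUnit_iff_ne_zero.mpr (by simpa using hx))
  by_cases hk : coeffVec α k = 0
  · have : IsUnit (shift k α) := by
      rw [shift_linearForm k hα, hk]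
      simpa using hα0
    exact isCoprime_of_isUnit (a := 1) (b := 0) (by ring) this
  · have hne : coeffVec β k • α - coeffVec α k • β ≠ 0 := by
      intro h'
      rw [sub_eq_zero] at h'
      have hβ' : β = (coeffVec β k / coeffVec α k) • α := by
        rw [div_eq_inv_mul, mul_smul, h', smul_smul, inv_mul_cancel₀ hk, one_smul]
      refine h ⟨_, ?_, hβ'⟩
      intro hc
      rw [hc, zero_smul] at hβ'
      exact hβ0 hβ'
    have hcomb : algebraMap ℂ _ (coeffVec β k) * shift k α +
        algebraMap ℂ _ (-coeffVec α k) * shift k β =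
        Polynomial.C (algebraMap Poly (FractionRing Poly)
          (coeffVec β k • α - coeffVec α k • β)) := by
      have key (c : ℂ) : algebraMap ℂ (Polynomial (FractionRing Poly)) c =
        Polynomial.C (algebraMap ℂ (FractionRing Poly) c) := rfl
      have key' (c : ℂ) : algebraMap Poly (FractionRing Poly) (C c) =
        algebraMap ℂ (FractionRing Poly) c := rfl
      rw [shift_linearForm k hα, shift_linearForm k hβ]
      simp only [smul_eq_C_mul, map_sub, map_mul, map_neg, key, key']
      ring
    exact isCoprime_of_isUnit hcomb (isUnit_C hne)

/-- `D` is a nonconstant product of lines contained in the curve `F`, and `F` is a constant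
multiple of `D ^ e`. -/
def IsRootCurve (F : Poly) (e : ℕ) (D : Poly) : Prop :=
  ∃ (q : ℕ) (α : Fin q → Poly) (k : Fin q → ℕ), 0 < q ∧
    (∀ i, (α i).IsHomogeneous 1 ∧ α i ≠ 0) ∧ (∀ i, 0 < k i) ∧ (∀ i, α i ∣ F) ∧
    D = ∏ i, α i ^ k i ∧ ∃ c : ℂ, c ≠ 0 ∧ F = c • D ^ e

theorem HasExponent.exists_isRootCurve {F : Poly} {e : ℕ} (h : HasExponent F e) (he : e ≠ 0) :
    ∃ D, IsRootCurve F e D := by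
  obtain ⟨q, α, m, hfac, hgcd⟩ := h
  have hem (i : Fin q) : e ∣ m i := hgcd ▸ Finset.gcd_dvd (Finset.mem_univ i)
  obtain ⟨c, hc, hF⟩ := hfac.2.2.2
  refine ⟨_, q, α, fun i => m i / e, ?_, hfac.1, fun i => ?_, hfac.dvd, rfl, c, hc, ?_⟩
  · refine Nat.pos_of_ne_zero ?_
    rintro rfl
    exact he (by rw [← hgcd, Finset.univ_eq_empty, Finset.gcd_empty])
  · exact Nat.div_pos (Nat.le_of_dvd (hfac.2.2.1 i) (hem i)) (Nat.pos_of_ne_zero he)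
  · rw [hF, ← Finset.prod_pow]
    simp_rw [← pow_mul, Nat.div_mul_cancel (hem _)]

theorem IsRootCurve.shift_ne_zero {F D : Poly} {e : ℕ} (h : IsRootCurve F e D) (k : Fin 3) :
    shift k D ≠ 0 := by
  obtain ⟨q, α, m, -, hα, -, -, rfl, -⟩ := h
  rw [map_prod, Finset.prod_ne_zero_iff]
  intro i _
  rw [map_pow]
  exact pow_ne_zero _ (shift_linearForm_ne_zero k (hα i).1 (hα i).2)

/-- A line of `D` has some nonzero coefficient; in that direction its image has degree 1 and divides
the image of `D`. -/
theorem IsRootCurve.exists_natDegree_shift_ne_zero {F D : Poly} {e : ℕ} (h : IsRootCurve F e D) :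
    ∃ k, (shift k D).natDegree ≠ 0 := by
  have hD := h.shift_ne_zero
  obtain ⟨q, α, m, hq, hα, hm, -, rfl, -⟩ := h
  obtain ⟨k, hk⟩ := Function.ne_iff.mp (coeffVec_ne_zero (hα ⟨0, hq⟩).1 (hα ⟨0, hq⟩).2)
  refine ⟨k, fun h0 => ?_⟩
  have hdvd : shift k (α ⟨0, hq⟩) ∣ shift k (∏ i, α i ^ m i) :=
    map_dvd _ ((dvd_pow_self _ (hm _).ne').trans (Finset.dvd_prod_of_mem _ (Finset.mem_univ _)))
  have := Polynomial.natDegree_le_of_dvd hdvd (hD k)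
  rw [natDegree_shift_linearForm (hα _).1 hk, h0] at this
  omega

theorem IsRootCurve.isCoprime_shift {F G D E : Poly} {e f : ℕ} (hD : IsRootCurve F e D)
    (hE : IsRootCurve G f E) (h : ∀ α, α ∣ F → α ∣ G → IsUnit α) (k : Fin 3) :
    IsCoprime (shift k D) (shift k E) := by
  obtain ⟨q, α, m, -, hα, -, hαF, rfl, -⟩ := hD
  obtain ⟨r, β, n, -, hβ, -, hβG, rfl, -⟩ := hE
  simp only [map_prod, map_pow]
  refine IsCoprime.prod_left fun i _ => IsCoprime.prod_right fun j _ => IsCoprime.pow ?_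
  refine PlanePencil.isCoprime_shift k (hα i).1 (hα i).2 (hβ j).1 (hβ j).2 ?_
  rintro ⟨c, -, hc⟩
  refine (prime_linearForm (hα i).1 (hα i).2).not_isUnit (h _ (hαF i) (dvd_trans ?_ (hβG j)))
  rw [hc]
  exact dvd_smul_of_dvd c dvd_rfl

/-- By the polynomial Fermat–Catalan theorem, the exponents of three fibers of a pencil without
fixed components are not of Euclidean or hyperbolic type. -/
theorem lt_of_hasExponent {L : Submodule ℂ Poly} (hL : Module.finrank ℂ L = 2)
    (hfix : HasNoFixedComponent L) {F G H : Poly} (hF : F ∈ L) (hG : G ∈ L) (hH : H ∈ L)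
    (hFG : ¬ SameCurve F G) (hFH : ¬ SameCurve F H) (hGH : ¬ SameCurve G H) {e f g : ℕ}
    (he : HasExponent F e) (hf : HasExponent G f) (hg : HasExponent H g)
    (he0 : e ≠ 0) (hf0 : f ≠ 0) (hg0 : g ≠ 0) : e * f * g < f * g + g * e + e * f := by
  by_contra! hineq
  have hF0 := he.isCompletelyReducible.ne_zero
  have hG0 := hf.isCompletelyReducible.ne_zero
  have hH0 := hg.isCompletelyReducible.ne_zero
  obtain ⟨a, b, ha, hb, hrel⟩ := exists_relation hL hF hG hH hF0 hG0 hH0 hFG hFH hGH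
  obtain ⟨A, hA⟩ := he.exists_isRootCurve he0
  obtain ⟨B, hB⟩ := hf.exists_isRootCurve hf0
  obtain ⟨D, hD⟩ := hg.exists_isRootCurve hg0
  obtain ⟨k, hk⟩ := hA.exists_natDegree_shift_ne_zero
  have hcop := hA.isCoprime_shift hB (fun α hαF hαG => hfix α fun K hK => by
    obtain ⟨s, t, rfl⟩ := exists_eq_smul_add_smul hL hF hG hF0 hG0 hFG hK
    exact dvd_add (dvd_smul_of_dvd s hαF) (dvd_smul_of_dvd t hαG)) k
  have hA0 := hA.shift_ne_zero k
  have hB0 := hB.shift_ne_zero k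
  have hD0 := hD.shift_ne_zero k
  obtain ⟨-, -, -, -, -, -, -, -, x, hx, rfl⟩ := hA
  obtain ⟨-, -, -, -, -, -, -, -, y, hy, rfl⟩ := hB
  obtain ⟨-, -, -, -, -, -, -, -, z, hz, rfl⟩ := hD
  let ι : ℂ →+* FractionRing Poly := algebraMap ℂ (FractionRing Poly)
  have hι {c : ℂ} (hc : c ≠ 0) : ι c ≠ 0 := (map_ne_zero ι).mpr hc
  have hcast {n : ℕ} (hn : n ≠ 0) : (n : FractionRing Poly) ≠ 0 := by
    have := hι (Nat.cast_ne_zero.mpr hn)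
    rwa [map_natCast] at this
  have hsmul (c : ℂ) (P : Polynomial (FractionRing Poly)) : c • P = Polynomial.C (ι c) * P :=
    Algebra.smul_def c P
  -- Fermat–Catalan would make all three shifted roots constant, against the choice of `k` for the
  -- first one.
  refine hk (Polynomial.flt_catalan he0 hf0 hg0 hineq (hcast he0) (hcast hf0) (hcast hg0)
    hA0 hB0 hD0 hcop (hι (mul_ne_zero ha hx)) (hι (mul_ne_zero hb hy)) (hι (neg_ne_zero.mpr hz))
    ?_).1
  have := congrArg (shift k) hrel
  simp only [map_add, map_smul, map_pow, smul_smul] at this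
  rw [← hsmul, ← hsmul, ← hsmul, ← this, neg_smul, add_neg_cancel]

/-! ### Arithmetic of the exponents -/

/-- The inequality says `1/a + 1/b + 1/c > 1`. The sum is at most `1/3 + 1/4 + 1/5` if `a ≥ 3` and
at most `1/2 + 1/4 + 1/5` if `a = 2`, `b ≥ 4`; both are below 1. For `a = 2`, `b = 3` it gives `c <
6`, and 4 is not coprime to 2. -/
theorem eq_two_three_five_of_lt {a b c : ℕ} (ha : 1 < a) (hab : a < b) (hbc : b < c)
    (h1 : a.Coprime b) (h2 : a.Coprime c) (h3 : b.Coprime c)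
    (h : a * b * c < b * c + c * a + a * b) : a = 2 ∧ b = 3 ∧ c = 5 := by
  have ha2 : a = 2 := by
    by_contra hne
    have : 3 ≤ a := by omega
    nlinarith [Nat.mul_le_mul_right (b * c) this, Nat.mul_le_mul hab.le hbc.le,
      Nat.mul_lt_mul_of_pos_left hab (show 0 < c by omega),
      Nat.mul_lt_mul_of_pos_left hbc (show 0 < a by omega),
      Nat.mul_lt_mul_of_pos_left hbc (show 0 < b by omega)]
  subst ha2
  have hb3 : b = 3 := by
    by_contra hne
    have hb4 : 4 ≤ b := by omega
    nlinarith [Nat.mul_le_mul_right c hb4]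
  subst hb3
  have hc : c < 6 := by omega
  interval_cases c
  · exact absurd h2 (by decide)
  · simp

theorem image_eq_two_three_five {e : Fin 3 → ℕ} (he : ∀ i, 1 < e i)
    (hcop : ∀ i j, i ≠ j → (e i).Coprime (e j))
    (h : e 0 * e 1 * e 2 < e 1 * e 2 + e 2 * e 0 + e 0 * e 1) :
    Finset.univ.image e = {2, 3, 5} := by
  have hne (i j : Fin 3) (hij : i ≠ j) : e i ≠ e j := fun h' => by
    have := hcop i j hij
    rw [h', Nat.coprime_self] at this
    exact (he j).ne' this
  have key (i j k : Fin 3) (hij : e i < e j) (hjk : e j < e k)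
      (hs : ∀ t : Fin 3, t = i ∨ t = j ∨ t = k)
      (h' : e i * e j * e k < e j * e k + e k * e i + e i * e j) :
      Finset.univ.image e = {2, 3, 5} := by
    have hij' : i ≠ j := fun h => hij.ne (h ▸ rfl)
    have hjk' : j ≠ k := fun h => hjk.ne (h ▸ rfl)
    have hik' : i ≠ k := fun h => (hij.trans hjk).ne (h ▸ rfl)
    obtain ⟨hi, hj, hk⟩ := eq_two_three_five_of_lt (he i) hij hjk (hcop i j hij')
      (hcop i k hik') (hcop j k hjk') h'
    have huniv : (Finset.univ : Finset (Fin 3)) = {i, j, k} := by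
      ext t
      simpa using hs t
    rw [huniv, Finset.image_insert, Finset.image_insert, Finset.image_singleton, hi, hj, hk]
  have h01 := hne 0 1 (by decide)
  have h02 := hne 0 2 (by decide)
  have h12 := hne 1 2 (by decide)
  -- Of the eight sign patterns, six are orderings and two are cyclic, hence impossible.
  rcases lt_or_gt_of_ne h01 with h01 | h01 <;> rcases lt_or_gt_of_ne h02 with h02 | h02 <;>
    rcases lt_or_gt_of_ne h12 with h12 | h12
  · exact key 0 1 2 h01 h12 (by decide) h
  · exact key 0 2 1 h02 h12 (by decide) (by linarith)
  · omega
  · exact key 2 0 1 h02 h01 (by decide) (by linarith)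
  · exact key 1 0 2 h01 h02 (by decide) (by linarith)
  · omega
  · exact key 1 2 0 h12 h02 (by decide) (by linarith)
  · exact key 2 1 0 h12 h01 (by decide) (by linarith)

theorem IsCompletelyReducible.exists_hasExponent {d : ℕ} (hd : d ≠ 0) {F : Poly}
    (hF : F.IsHomogeneous d) (h : IsCompletelyReducible F) : ∃ e, e ≠ 0 ∧ HasExponent F e := by
  obtain ⟨q, α, m, hfac⟩ := h
  refine ⟨Finset.univ.gcd m, fun h0 => ?_, q, α, m, hfac, rfl⟩
  rw [Finset.gcd_eq_zero_iff] at h0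
  obtain ⟨-, -, hm, c, hc, rfl⟩ := hfac
  -- Positive multiplicities with gcd 0 mean that there are no lines, so `F` is a nonzero constant,
  -- against `d ≠ 0`.
  have hempty : IsEmpty (Fin q) := ⟨fun i => (hm i).ne' (h0 i (Finset.mem_univ i))⟩
  have := eval_zero_of_isHomogeneous hd hF
  rw [Finset.univ_eq_empty, Finset.prod_empty, smul_eval, map_one, mul_one] at this
  exact hc this

end PlanePencil

end

open PlanePencil

/-! ### The exponents of a Ceva pencil -/

theorem theorem3p15 (d : ℕ) (L : Submodule ℂ PlanePencil.Poly)
    (hL : PlanePencil.IsCevaPencil d L)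
    (F : Fin 3 → PlanePencil.Poly) (e : Fin 3 → ℕ)
    (hF : ∀ i, F i ∈ L)
    (hdist : ∀ i j, i ≠ j → ¬ PlanePencil.SameCurve (F i) (F j))
    (hexp : ∀ i, PlanePencil.HasExponent (F i) (e i))
    (he : ∀ i, 1 < e i) :
    Finset.univ.image e = {2, 3, 5} ∧
      ∀ G ∈ L, PlanePencil.IsCompletelyReducible G →
        (∀ i, ¬ PlanePencil.SameCurve (F i) G) → PlanePencil.HasExponent G 1 := by
  have hred (i : Fin 3) := (hexp i).isCompletelyReducible
  have he0 (i : Fin 3) : e i ≠ 0 := (zero_lt_one.trans (he i)).ne'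
  have hthird : ∀ i j : Fin 3, i ≠ j → ∃ k, i ≠ k ∧ j ≠ k := by decide
  have himage : Finset.univ.image e = {2, 3, 5} := by
    refine image_eq_two_three_five he (fun i j hij => ?_) ?_
    · obtain ⟨k, hik, hjk⟩ := hthird i j hij
      exact coprime_exponents hL.isPencil hL.noFixedComponent hL.connected (hF i) (hF j) (hF k)
        (hdist i j hij) (hdist i k hik) (hdist j k hjk) (hexp i) (hexp j) (hred k) (he0 i) (he0 j)
    · exact lt_of_hasExponent hL.isPencil.2 hL.noFixedComponent (hF 0) (hF 1) (hF 2)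
        (hdist 0 1 (by decide)) (hdist 0 2 (by decide)) (hdist 1 2 (by decide)) (hexp 0) (hexp 1)
        (hexp 2) (he0 0) (he0 1) (he0 2)
  refine ⟨himage, fun G hG hGred hGdist => ?_⟩
  have hd := degree_ne_zero (hL.isPencil.1 (hF 0)) (hL.isPencil.1 (hF 1)) (hred 0).ne_zero
    (hred 1).ne_zero (hdist 0 1 (by decide))
  obtain ⟨g, hg0, hg⟩ := hGred.exists_hasExponent hd (hL.isPencil.1 hG)
  have hcop (i : Fin 3) : (e i).Coprime g := by
    obtain ⟨j, hij⟩ := exists_ne i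
    exact coprime_exponents hL.isPencil hL.noFixedComponent hL.connected (hF i) hG (hF j)
      (hGdist i) (hdist i j hij.symm) (fun h => hGdist j h.symm) (hexp i) hg (hred j) (he0 i) hg0
  by_cases hg1 : g = 1
  · exact hg1 ▸ hg
  have hlt := lt_of_hasExponent hL.isPencil.2 hL.noFixedComponent (hF 0) (hF 1) hG
    (hdist 0 1 (by decide)) (hGdist 0) (hGdist 1) (hexp 0) (hexp 1) hg (he0 0) (he0 1) hg0
  -- With `G` in place of `F 2` the exponents are again 2, 3, 5, so `g` is some `e i`, yet coprime
  -- to it.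
  have himage' : Finset.univ.image ![e 0, e 1, g] = {2, 3, 5} := by
    have h01 : (e 0).Coprime (e 1) :=
      coprime_exponents hL.isPencil hL.noFixedComponent hL.connected (hF 0) (hF 1) (hF 2)
        (hdist 0 1 (by decide)) (hdist 0 2 (by decide)) (hdist 1 2 (by decide)) (hexp 0) (hexp 1)
        (hred 2) (he0 0) (he0 1)
    refine image_eq_two_three_five (fun i => ?_) (fun i j hij => ?_) hlt
    · fin_cases i
      exacts [he 0, he 1, by simpa using by omega]
    · fin_cases i <;> fin_cases j
      exacts [absurd rfl hij, h01, hcop 0, h01.symm, absurd rfl hij, hcop 1, (hcop 0).symm,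
        (hcop 1).symm, absurd rfl hij]
  have hmem : g ∈ Finset.univ.image e := by
    rw [himage, ← himage']
    exact Finset.mem_image_of_mem ![e 0, e 1, g] (Finset.mem_univ 2)
  obtain ⟨i, -, rfl⟩ := Finset.mem_image.mp hmem
  exact absurd ((Nat.coprime_self _).mp (hcop i)) hg1
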